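/- Let $E$ be a complete separable metric space. Let $D_E[0,\infty)$ be the set of all RCLL paths $x:[0,\infty)\to E$ (right continuous on $[0,\infty)$, with left limits in $E$ at every $t>0$), equipped with the Skorokhod ($J_1$) topology: $x_n\to x$ iff there are increasing bijections $\lambda_n$ of $[0,\infty)$ with $\sup_{s<t}\bigl|\log\frac{\lambda_n(t)-\lambda_n(s)}{t-s}\bigr|\to 0$ and $\sup_{t\le T} d_E\bigl(x_n(t),x(\lambda_n(t))\bigr)\to 0$ for every $T\ge 0$. For $t\ge 0$ let $\theta_t:D_E[0,\infty)\to D_E[0,\infty)$, $(\theta_t x)(s)=x(s\wedge t)$, let $D_E[0,t]=\{x:\theta_t x=x\}$ carry the subspace topology, and let $$\mathcal F_t^{(E)}=\{\theta_t^{-1}(B): B\subseteq D_E[0,t]\text{ Borel}\},$$ a $\sigma$-algebra on $D_E[0,\infty)$. Then: 1. $D_E[0,\infty)$ and $E^*:=[0,\infty)\times D_E[0,\infty)$ (with the product topology) are Polish, i.e. separable and metrizable by a complete metric. 2. $\xi^*:[0,\infty)\times D_E[0,\infty)\to E^*$, $\xi^*(t,x)=(t,\theta_t x)$, is a stochastic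 process with RCLL paths: $x\mapsto\xi^*(t,x)$ is Borel measurable for each $t\ge0$, and $t\mapsto\xi^*(t,x)$ is RCLL in $E^*$ for each $x\in D_E[0,\infty)$. 3. Let $D_{E^*}[0,\infty)$, its topology and $\mathcal F_t^{(E^*)}$ be defined in the same way with $E^*$ in place of $E$, and let $\widetilde{\xi^*}:D_E[0,\infty)\to D_{E^*}[0,\infty)$, $x\mapsto\xi^*(\cdot,x)$. Then for every $t\ge 0$ $$\widetilde{\xi^*}^{-1}\bigl(\mathcal F_t^{(E^*)}\bigr)=\mathcal F_t^{(E)} .$$ Moreover $\mathcal F_t^{(E)}=\sigma(\pi_s: s\le t)$ and $\mathcal F_t^{(E^*)}=\sigma(\pi_s:s\le t)$, where $\pi_s$ denotes evaluation at time $s$ on $D_E[0,\infty)$, respectively on $D_{E^*}[0,\infty)$. -/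

import Mathlib

open Set Filter Topology Uniformity
open scoped NNReal MeasureTheory

/-- A path `x : [0,∞) → E` is RCLL: right continuous with left limits. -/
def IsRCLL {E : Type*} [TopologicalSpace E] (x : ℝ≥0 → E) : Prop :=
  (∀ t, ContinuousWithinAt x (Ici t) t) ∧
    ∀ t, 0 < t → ∃ l, Tendsto x (𝓝[<] t) (𝓝 l)

/-- The set `D_E[0,∞)` of RCLL paths in `E`. -/
@[ext]
structure SkorokhodSpace (E : Type*) [TopologicalSpace E] where
  toFun : ℝ≥0 → E
  isRCLL : IsRCLL toFun

namespace SkorokhodSpace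

instance {E : Type*} [TopologicalSpace E] : CoeFun (SkorokhodSpace E) (fun _ => ℝ≥0 → E) :=
  ⟨SkorokhodSpace.toFun⟩

/-- For an increasing bijection `φ` of `[0,∞)`, the condition
`sup_{s < t} |log ((φ t - φ s) / (t - s))| ≤ ε`, written without logarithms. -/
def TimeChangeLE (φ : ℝ≥0 ≃o ℝ≥0) (ε : ℝ) : Prop :=
  ∀ s t : ℝ≥0, s ≤ t →
    Real.exp (-ε) * ((t : ℝ) - s) ≤ (φ t : ℝ) - φ s ∧
      (φ t : ℝ) - φ s ≤ Real.exp ε * ((t : ℝ) - s)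

/-- Pairs of paths that are `U`-close on `[0,T]` after a time change of size at most `ε`. -/
def entourage {E : Type*} [TopologicalSpace E] (U : Set (E × E)) (T : ℝ≥0) (ε : ℝ) :
    Set (SkorokhodSpace E × SkorokhodSpace E) :=
  {p | ∃ φ : ℝ≥0 ≃o ℝ≥0, TimeChangeLE φ ε ∧ ∀ t ≤ T, (p.1 t, p.2 (φ t)) ∈ U}

theorem TimeChangeLE.refl {ε : ℝ} (hε : 0 ≤ ε) : TimeChangeLE (OrderIso.refl ℝ≥0) ε := by
  intro s t h
  have h' : (0 : ℝ) ≤ (t : ℝ) - s := sub_nonneg.2 (by exact_mod_cast h)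
  have h1 : Real.exp (-ε) ≤ 1 := Real.exp_le_one_iff.2 (by linarith)
  have h2 : 1 ≤ Real.exp ε := Real.one_le_exp hε
  simp only [OrderIso.refl_apply]
  constructor <;> nlinarith

theorem TimeChangeLE.mono {φ : ℝ≥0 ≃o ℝ≥0} {ε δ : ℝ} (h : TimeChangeLE φ ε) (hδ : ε ≤ δ) :
    TimeChangeLE φ δ := by
  intro s t hst
  have h' : (0 : ℝ) ≤ (t : ℝ) - s := sub_nonneg.2 (by exact_mod_cast hst)
  obtain ⟨a, b⟩ := h s t hst
  exact ⟨le_trans (by gcongr) a, b.trans (by gcongr)⟩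

theorem TimeChangeLE.symm {φ : ℝ≥0 ≃o ℝ≥0} {ε : ℝ} (h : TimeChangeLE φ ε) :
    TimeChangeLE φ.symm ε := by
  intro s t hst
  obtain ⟨a, b⟩ := h (φ.symm s) (φ.symm t) (φ.symm.monotone hst)
  simp only [OrderIso.apply_symm_apply] at a b
  have e : Real.exp (-ε) * Real.exp ε = 1 := by rw [← Real.exp_add]; simp
  constructor
  · calc Real.exp (-ε) * ((t : ℝ) - s)
        ≤ Real.exp (-ε) * (Real.exp ε * ((φ.symm t : ℝ) - φ.symm s)) := by gcongr
      _ = (φ.symm t : ℝ) - φ.symm s := by rw [← mul_assoc, e, one_mul]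
  · calc (φ.symm t : ℝ) - φ.symm s
        = Real.exp ε * (Real.exp (-ε) * ((φ.symm t : ℝ) - φ.symm s)) := by
          rw [← mul_assoc, mul_comm (Real.exp ε), e, one_mul]
      _ ≤ Real.exp ε * ((t : ℝ) - s) := by gcongr

theorem TimeChangeLE.trans {φ ψ : ℝ≥0 ≃o ℝ≥0} {ε δ : ℝ} (h : TimeChangeLE φ ε)
    (h' : TimeChangeLE ψ δ) : TimeChangeLE (φ.trans ψ) (ε + δ) := by
  intro s t hst
  obtain ⟨a, b⟩ := h s t hst
  obtain ⟨c, d⟩ := h' (φ s) (φ t) (φ.monotone hst)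
  simp only [OrderIso.trans_apply]
  constructor
  · calc Real.exp (-(ε + δ)) * ((t : ℝ) - s)
        = Real.exp (-δ) * (Real.exp (-ε) * ((t : ℝ) - s)) := by
          rw [← mul_assoc, ← Real.exp_add]; ring_nf
      _ ≤ Real.exp (-δ) * ((φ t : ℝ) - φ s) := by gcongr
      _ ≤ _ := c
  · calc (ψ (φ t) : ℝ) - ψ (φ s) ≤ Real.exp δ * ((φ t : ℝ) - φ s) := d
      _ ≤ Real.exp δ * (Real.exp ε * ((t : ℝ) - s)) := by gcongr
      _ = Real.exp (ε + δ) * ((t : ℝ) - s) := by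
          rw [← mul_assoc, ← Real.exp_add]; ring_nf

theorem TimeChangeLE.apply_le {φ : ℝ≥0 ≃o ℝ≥0} {ε : ℝ} (h : TimeChangeLE φ ε) (t : ℝ≥0) :
    φ t ≤ Real.toNNReal (Real.exp ε) * t := by
  have h0 : φ 0 = 0 := φ.map_bot
  obtain ⟨_, b⟩ := h 0 t bot_le
  rw [h0] at b
  rw [← NNReal.coe_le_coe, NNReal.coe_mul, Real.coe_toNNReal _ (Real.exp_pos ε).le]
  simpa using b

/-- The entourages `entourage U T ε` form a basis of a uniformity. -/
def filterBasis (E : Type*) [UniformSpace E] :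
    FilterBasis (SkorokhodSpace E × SkorokhodSpace E) where
  sets := {V | ∃ U ∈ 𝓤 E, ∃ T : ℝ≥0, ∃ ε : ℝ, 0 < ε ∧ V = entourage U T ε}
  nonempty := ⟨_, univ, univ_mem, 0, 1, one_pos, rfl⟩
  inter_sets := by
    rintro _ _ ⟨U, hU, T, ε, hε, rfl⟩ ⟨U', hU', T', ε', hε', rfl⟩
    refine ⟨_, ⟨U ∩ U', inter_mem hU hU', max T T', min ε ε', lt_min hε hε', rfl⟩, ?_⟩
    rintro p ⟨φ, hφ, h⟩
    exact ⟨⟨φ, hφ.mono (min_le_left _ _), fun t ht => (h t (ht.trans (le_max_left _ _))).1⟩,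
      ⟨φ, hφ.mono (min_le_right _ _), fun t ht => (h t (ht.trans (le_max_right _ _))).2⟩⟩

/-- The Skorokhod (J1) uniformity and topology on `D_E[0,∞)`: a sequence `x n` converges to `x`
iff there are time changes `φ n` with `sup_{s<t} |log ((φ n t - φ n s) / (t - s))| → 0` such that
`x n t` and `x (φ n t)` become close uniformly in `t ∈ [0,T]`, for every `T`. -/
instance instUniformSpace (E : Type*) [UniformSpace E] : UniformSpace (SkorokhodSpace E) :=
  UniformSpace.ofCore <| UniformSpace.Core.mkOfBasis (filterBasis E)
    (by
      rintro _ ⟨U, hU, T, ε, hε, rfl⟩ x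
      exact ⟨OrderIso.refl _, TimeChangeLE.refl hε.le, fun t _ => refl_mem_uniformity hU⟩)
    (by
      rintro _ ⟨U, hU, T, ε, hε, rfl⟩
      refine ⟨_, ⟨Prod.swap ⁻¹' U, symm_le_uniformity hU,
        Real.toNNReal (Real.exp ε) * T, ε, hε, rfl⟩, ?_⟩
      rintro ⟨x, y⟩ ⟨φ, hφ, h⟩
      refine ⟨φ.symm, hφ.symm, fun t ht => ?_⟩
      have := h (φ.symm t) ((hφ.symm.apply_le t).trans (by gcongr))
      simpa using this)
    (by
      rintro _ ⟨U, hU, T, ε, hε, rfl⟩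
      obtain ⟨U', hU', hc⟩ := comp_mem_uniformity_sets hU
      refine ⟨_, ⟨U', hU', max T (Real.toNNReal (Real.exp (ε / 2)) * T), ε / 2, half_pos hε,
        rfl⟩, ?_⟩
      rintro ⟨x, z⟩ ⟨y, ⟨φ, hφ, h⟩, ⟨ψ, hψ, h'⟩⟩
      refine ⟨φ.trans ψ, by simpa using hφ.trans hψ, fun t ht => hc ⟨y (φ t), ?_, ?_⟩⟩
      · exact h t (ht.trans (le_max_left _ _))
      · exact h' (φ t) (((hφ.apply_le t).trans (by gcongr)).trans (le_max_right _ _)))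

/-- The operator `θ_t`: the path `x` stopped at time `t`, i.e. `s ↦ x (s ∧ t)`. -/
def theta {E : Type*} [TopologicalSpace E] (t : ℝ≥0) (x : SkorokhodSpace E) :
    SkorokhodSpace E where
  toFun s := x (min s t)
  isRCLL := by
    constructor
    · intro s
      exact (x.isRCLL.1 (min s t)).comp (f := fun r => min r t)
        (by fun_prop) (fun r hr => min_le_min_right t hr)
    · intro s hs
      rcases le_or_gt s t with h | h
      · obtain ⟨l, hl⟩ := x.isRCLL.2 s hs
        refine ⟨l, hl.congr' ?_⟩
        filter_upwards [self_mem_nhdsWithin] with r hr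
        rw [min_eq_left ((le_of_lt hr).trans h)]
      · refine ⟨x t, tendsto_const_nhds.congr' ?_⟩
        filter_upwards [mem_nhdsWithin_of_mem_nhds (Ioi_mem_nhds h)] with r hr
        rw [min_eq_right (le_of_lt hr)]

theorem theta_theta {E : Type*} [TopologicalSpace E] (t : ℝ≥0) (x : SkorokhodSpace E) :
    theta t (theta t x) = theta t x := by
  ext s
  simp [theta]

/-- `D_E[0,t]`, the set of fixed points of `θ_t`, with the subspace topology of `D_E[0,∞)`. -/
abbrev upTo (E : Type*) [TopologicalSpace E] (t : ℝ≥0) : Set (SkorokhodSpace E) :=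
  Function.fixedPoints (theta t)

/-- The map `D_E[0,∞) → D_E[0,t]` induced by `θ_t`. -/
def thetaTo {E : Type*} [TopologicalSpace E] (t : ℝ≥0) (x : SkorokhodSpace E) : upTo E t :=
  ⟨theta t x, theta_theta t x⟩

/-- The σ-algebra `F_t^{(E)}` on `D_E[0,∞)`: the preimages of the Borel sets of `D_E[0,t]`
under the map induced by `θ_t`. -/
abbrev filtration (E : Type*) [UniformSpace E] (t : ℝ≥0) : MeasurableSpace (SkorokhodSpace E) :=
  (borel (upTo E t)).comap (thetaTo t)

/-- The σ-algebra `σ(π_s | s ≤ t)` on `D_E[0,∞)` generated by the evaluations up to time `t`. -/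
abbrev evalSigma (E : Type*) [TopologicalSpace E] (t : ℝ≥0) : MeasurableSpace (SkorokhodSpace E) :=
  ⨆ s : Iic t, (borel E).comap (fun x : SkorokhodSpace E => x s)

/-- The space `E* = [0,∞) × D_E[0,∞)`, with the product topology. -/
abbrev EStar (E : Type*) [TopologicalSpace E] : Type _ := ℝ≥0 × SkorokhodSpace E

/-- The process `ξ*(t, x) = (t, θ_t x)`. -/
def xiStar {E : Type*} [TopologicalSpace E] (t : ℝ≥0) (x : SkorokhodSpace E) : EStar E :=
  (t, theta t x)

end SkorokhodSpace

/-!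
The logarithmic slope bounds of time changes add up under composition, so an infinite composition
of time changes with summable bounds converges. Reparametrising a fast Cauchy sequence of paths
along such compositions makes it uniformly Cauchy on bounded time intervals, and its locally uniform
limit is RCLL: the Skorokhod space is complete. It is separable because an RCLL path oscillates
little on each piece of some finite partition of `[0,T]`, so that step paths with rational holding
times are dense.

Right continuity expresses `x s` through the values of `x` on `(s, s + 1/n)`, which makes
evaluations Borel, and countably many of them separate paths. By the Lusin–Souslin theorem the
Borel σ-algebra of a Polish Skorokhod space is therefore generated by the evaluations. Pulling this
back along `θ_t` identifies `F_t` with `σ(π_s | s ≤ t)`; for the process `ξ*` both sides of the last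
claim are then generated by the same evaluations.
-/

namespace SkorokhodSpace

/-! ### Time changes -/

/-- The bound `|log ((f t - f s) / (t - s))| ≤ ε` on the slopes of a self-map `f` of `[0,∞)`; this
is `TimeChangeLE` for functions that are not yet known to be bijective. -/
def LogSlopeLE (f : ℝ≥0 → ℝ≥0) (ε : ℝ) : Prop :=
  ∀ s t : ℝ≥0, s ≤ t →
    Real.exp (-ε) * ((t : ℝ) - s) ≤ (f t : ℝ) - f s ∧
      (f t : ℝ) - f s ≤ Real.exp ε * ((t : ℝ) - s)

namespace LogSlopeLE

variable {f g : ℝ≥0 → ℝ≥0} {ε : ℝ}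

theorem strictMono (hf : LogSlopeLE f ε) : StrictMono f := by
  intro s t hst
  have hpos : 0 < Real.exp (-ε) * ((t : ℝ) - s) :=
    mul_pos (Real.exp_pos _) (sub_pos.2 (NNReal.coe_lt_coe.2 hst))
  exact NNReal.coe_lt_coe.1 (sub_pos.1 (hpos.trans_le (hf s t hst.le).1))

theorem lipschitzWith (hf : LogSlopeLE f ε) : LipschitzWith (Real.exp ε).toNNReal f := by
  refine LipschitzWith.of_dist_le_mul fun s t => ?_
  wlog hst : s ≤ t generalizing s t
  · rw [dist_comm, dist_comm s]
    exact this t s (le_of_not_ge hst)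
  rw [dist_comm, dist_comm s, Real.coe_toNNReal _ (Real.exp_pos ε).le, NNReal.dist_eq,
    NNReal.dist_eq, abs_of_nonneg (sub_nonneg.2 (NNReal.coe_le_coe.2 hst)),
    abs_of_nonneg (sub_nonneg.2 (NNReal.coe_le_coe.2 (hf.strictMono.monotone hst)))]
  exact (hf s t hst).2

theorem surjective (hf : LogSlopeLE f ε) (h0 : f 0 = 0) : Function.Surjective f := by
  intro u
  refine mem_range_of_exists_le_of_exists_ge hf.lipschitzWith.continuous ⟨0, h0.trans_le zero_le⟩
    ⟨(Real.exp ε).toNNReal * u, ?_⟩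
  have hlower := (hf 0 ((Real.exp ε).toNNReal * u) zero_le).1
  simpa [h0, ← mul_assoc, ← Real.exp_add, (Real.exp_pos ε).le] using hlower

/-- The time change given by a function with bounded logarithmic slopes that fixes `0`. -/
noncomputable def toOrderIso (hf : LogSlopeLE f ε) (h0 : f 0 = 0) : ℝ≥0 ≃o ℝ≥0 :=
  hf.strictMono.orderIsoOfSurjective f (hf.surjective h0)

@[simp]
theorem coe_toOrderIso (hf : LogSlopeLE f ε) (h0 : f 0 = 0) : ⇑(hf.toOrderIso h0) = f := rfl

theorem of_tendsto {ι : Type*} {l : Filter ι} [l.NeBot] {F : ι → ℝ≥0 → ℝ≥0}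
    (hF : ∀ᶠ i in l, LogSlopeLE (F i) ε) (hlim : ∀ t, Tendsto (fun i => F i t) l (𝓝 (f t))) :
    LogSlopeLE f ε := by
  intro s t hst
  have hdiff : Tendsto (fun i => (F i t : ℝ) - F i s) l (𝓝 ((f t : ℝ) - f s)) :=
    (NNReal.tendsto_coe.2 (hlim t)).sub (NNReal.tendsto_coe.2 (hlim s))
  exact ⟨ge_of_tendsto hdiff (hF.mono fun i hi => (hi s t hst).1),
    le_of_tendsto hdiff (hF.mono fun i hi => (hi s t hst).2)⟩

/-- Truncated subtraction makes this `f` on `[0,d]`, followed by `g` from time `d` on. -/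
theorem concat (hf : LogSlopeLE f ε) (hg : LogSlopeLE g ε) (d : ℝ≥0) :
    LogSlopeLE (fun t => f (min t d) + g (t - d)) ε := by
  intro s t hst
  have split_time (r : ℝ≥0) : (r : ℝ) = (min r d : ℝ≥0) + (r - d : ℝ≥0) := by
    exact_mod_cast (add_comm _ _).trans (tsub_add_min (a := r) (b := d)) |>.symm
  obtain ⟨hf₁, hf₂⟩ := hf _ _ (min_le_min_right d hst)
  obtain ⟨hg₁, hg₂⟩ := hg _ _ (tsub_le_tsub_right hst d)
  rw [split_time s, split_time t, NNReal.coe_add, NNReal.coe_add]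
  constructor <;> linarith

end LogSlopeLE

namespace TimeChangeLE

variable {φ ψ : ℝ≥0 ≃o ℝ≥0} {ε : ℝ}

theorem nonneg (h : TimeChangeLE φ ε) : 0 ≤ ε := by
  obtain ⟨hlower, hupper⟩ := h 0 1 zero_le
  have hexp : Real.exp (-ε) ≤ Real.exp ε := by simpa using hlower.trans hupper
  linarith [Real.exp_le_exp.1 hexp]

theorem dist_apply_le (h : TimeChangeLE φ ε) (t : ℝ≥0) :
    dist t (φ t) ≤ (Real.exp ε - 1) * t := by
  have h0 : φ 0 = 0 := φ.map_bot
  obtain ⟨hlower, hupper⟩ := h 0 t zero_le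
  simp only [h0, NNReal.coe_zero, sub_zero] at hlower hupper
  have hexp : 2 ≤ Real.exp ε + Real.exp (-ε) := by
    linarith [Real.one_le_cosh ε, Real.cosh_eq ε]
  rw [NNReal.dist_eq, abs_le]
  constructor <;> nlinarith [t.coe_nonneg]

theorem exists_pos_forall_apply_mem {t : ℝ≥0} {V : Set ℝ≥0} (hV : V ∈ 𝓝 t) :
    ∃ ε > 0, ∀ φ, TimeChangeLE φ ε → φ t ∈ V := by
  obtain ⟨δ, hδ, hball⟩ := Metric.mem_nhds_iff.1 hV
  have hcont : Continuous fun ε : ℝ => (Real.exp ε - 1) * t := by fun_prop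
  have hsmall : ∀ᶠ ε in 𝓝[>] (0 : ℝ), (Real.exp ε - 1) * t < δ :=
    nhdsWithin_le_nhds (hcont.tendsto 0 |>.eventually_lt_const (by simpa using hδ))
  obtain ⟨ε, hεδ, hε⟩ := (hsmall.and self_mem_nhdsWithin).exists
  refine ⟨ε, hε, fun φ hφ => hball ?_⟩
  rw [Metric.mem_ball, dist_comm]
  exact (hφ.dist_apply_le t).trans_lt hεδ

theorem mulRight₀ {c : ℝ≥0} (hc : 0 < c) (hlower : Real.exp (-ε) ≤ c)
    (hupper : (c : ℝ) ≤ Real.exp ε) : TimeChangeLE (OrderIso.mulRight₀ c hc) ε := by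
  intro s t hst
  have hst' : (0 : ℝ) ≤ t - s := sub_nonneg.2 (NNReal.coe_le_coe.2 hst)
  have hdiff : (OrderIso.mulRight₀ c hc t : ℝ) - OrderIso.mulRight₀ c hc s = c * (t - s) := by
    simp only [OrderIso.mulRight₀_apply, NNReal.coe_mul]
    ring
  rw [hdiff]
  constructor <;> gcongr

theorem exists_concat (hφ : TimeChangeLE φ ε) (hψ : TimeChangeLE ψ ε) (d : ℝ≥0) :
    ∃ χ : ℝ≥0 ≃o ℝ≥0, TimeChangeLE χ ε ∧ (∀ t ≤ d, χ t = φ t) ∧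
      ∀ t, χ (d + t) = φ d + ψ t := by
  have hφ0 : φ 0 = 0 := φ.map_bot
  have hψ0 : ψ 0 = 0 := ψ.map_bot
  have hslope : LogSlopeLE (fun t => φ (min t d) + ψ (t - d)) ε := LogSlopeLE.concat hφ hψ d
  refine ⟨hslope.toOrderIso (by simp [hφ0, hψ0]), hslope, fun t ht => ?_, fun t => ?_⟩
  · simp [tsub_eq_zero_of_le ht, hψ0, ht]
  · simp

end TimeChangeLE

/-! ### Infinite compositions of time changes -/

/-- The composition `φ (n - 1) ∘ ⋯ ∘ φ 0`, which transports times of the `0`-th path to times of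
the `n`-th path of a sequence whose consecutive terms are compared through `φ`. -/
def iterTimeChange (φ : ℕ → ℝ≥0 ≃o ℝ≥0) : ℕ → ℝ≥0 ≃o ℝ≥0
  | 0 => OrderIso.refl _
  | n + 1 => (iterTimeChange φ n).trans (φ n)

section IterTimeChange

variable {φ : ℕ → ℝ≥0 ≃o ℝ≥0} {ε : ℕ → ℝ}

theorem timeChangeLE_iterTimeChange_add (hφ : ∀ n, TimeChangeLE (φ n) (ε n)) (n k : ℕ) :
    TimeChangeLE ((iterTimeChange φ n).symm.trans (iterTimeChange φ (k + n)))
      (∑ i ∈ Finset.range k, ε (i + n)) := by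
  induction k with
  | zero => simpa using TimeChangeLE.refl le_rfl
  | succ k ih =>
    rw [Finset.sum_range_succ, add_right_comm]
    exact ih.trans (hφ (k + n))

theorem timeChangeLE_iterTimeChange_of_le (hφ : ∀ n, TimeChangeLE (φ n) (ε n)) (hε : Summable ε)
    {n m : ℕ} (hnm : n ≤ m) :
    TimeChangeLE ((iterTimeChange φ n).symm.trans (iterTimeChange φ m)) (∑' i, ε (i + n)) := by
  obtain ⟨k, rfl⟩ := exists_add_of_le hnm
  rw [add_comm n]
  exact (timeChangeLE_iterTimeChange_add hφ n k).mono
    (((summable_nat_add_iff n).2 hε).sum_le_tsum _ fun i _ => (hφ _).nonneg)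

theorem iterTimeChange_apply_le (hφ : ∀ n, TimeChangeLE (φ n) (ε n)) (hε : Summable ε) (n : ℕ)
    (t : ℝ≥0) : iterTimeChange φ n t ≤ (Real.exp (∑' i, ε i)).toNNReal * t :=
  (timeChangeLE_iterTimeChange_of_le hφ hε n.zero_le).apply_le t

theorem cauchySeq_iterTimeChange_apply (hφ : ∀ n, TimeChangeLE (φ n) (ε n)) (hε : Summable ε)
    (t : ℝ≥0) : CauchySeq fun n => iterTimeChange φ n t := by
  set C : ℝ≥0 := (Real.exp (∑' i, ε i)).toNNReal
  refine cauchySeq_of_le_tendsto_0' (fun n => (Real.exp (∑' i, ε (i + n)) - 1) * (C * t : ℝ≥0))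
    (fun n m hnm => ?_) ?_
  · have htail := timeChangeLE_iterTimeChange_of_le hφ hε hnm
    calc dist (iterTimeChange φ n t) (iterTimeChange φ m t)
        ≤ (Real.exp (∑' i, ε (i + n)) - 1) * iterTimeChange φ n t := by
          simpa using htail.dist_apply_le (iterTimeChange φ n t)
      _ ≤ (Real.exp (∑' i, ε (i + n)) - 1) * (C * t : ℝ≥0) :=
          mul_le_mul_of_nonneg_left (NNReal.coe_le_coe.2 (iterTimeChange_apply_le hφ hε n t))
            (sub_nonneg.2 (Real.one_le_exp htail.nonneg))
  · simpa using ((tendsto_sum_nat_add ε).rexp.sub_const 1).mul_const ((C * t : ℝ≥0) : ℝ)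

theorem exists_timeChangeLE_symm_iterTimeChange_trans (hφ : ∀ n, TimeChangeLE (φ n) (ε n))
    (hε : Summable ε) : ∃ Λ : ℝ≥0 ≃o ℝ≥0, ∀ n,
      TimeChangeLE ((iterTimeChange φ n).symm.trans Λ) (∑' i, ε (i + n)) := by
  choose f hf using fun t => cauchySeq_tendsto_of_complete (cauchySeq_iterTimeChange_apply hφ hε t)
  have hslope (n : ℕ) : LogSlopeLE (f ∘ (iterTimeChange φ n).symm) (∑' i, ε (i + n)) :=
    LogSlopeLE.of_tendsto (eventually_atTop.2
      ⟨n, fun m hnm => timeChangeLE_iterTimeChange_of_le hφ hε hnm⟩) fun t => hf _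
  have hf0 : f 0 = 0 := tendsto_nhds_unique (hf 0)
    (tendsto_const_nhds.congr fun n => ((iterTimeChange φ n).map_bot).symm)
  exact ⟨(hslope 0).toOrderIso hf0, hslope⟩

end IterTimeChange

/-! ### The uniformity -/

section Uniformity

theorem entourage_mono {E : Type*} [TopologicalSpace E] {U U' : Set (E × E)} {T T' : ℝ≥0}
    {ε ε' : ℝ} (hU : U ⊆ U') (hT : T' ≤ T) (hε : ε ≤ ε') :
    entourage U T ε ⊆ entourage U' T' ε' :=
  fun _ ⟨φ, hφ, h⟩ => ⟨φ, hφ.mono hε, fun t ht => hU (h t (ht.trans hT))⟩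

variable {E : Type*} [UniformSpace E]

theorem hasBasis_uniformity (E : Type*) [UniformSpace E] :
    (𝓤 (SkorokhodSpace E)).HasBasis
      (fun p : Set (E × E) × ℝ≥0 × ℝ => p.1 ∈ 𝓤 E ∧ 0 < p.2.2)
      fun p => entourage p.1 p.2.1 p.2.2 :=
  (filterBasis E).hasBasis.to_hasBasis
    (fun _ ⟨U, hU, T, ε, hε, hV⟩ => ⟨(U, T, ε), ⟨hU, hε⟩, hV.ge⟩)
    fun p hp => ⟨_, ⟨p.1, hp.1, p.2.1, p.2.2, hp.2, rfl⟩, Subset.rfl⟩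

theorem entourage_mem_uniformity {U : Set (E × E)} (hU : U ∈ 𝓤 E) (T : ℝ≥0) {ε : ℝ}
    (hε : 0 < ε) : entourage U T ε ∈ 𝓤 (SkorokhodSpace E) :=
  (hasBasis_uniformity E).mem_of_mem (i := (U, T, ε)) ⟨hU, hε⟩

instance isCountablyGenerated_uniformity [(𝓤 E).IsCountablyGenerated] :
    (𝓤 (SkorokhodSpace E)).IsCountablyGenerated := by
  obtain ⟨U, hU⟩ := (𝓤 E).exists_antitone_basis
  have hbasis : (𝓤 (SkorokhodSpace E)).HasBasis (fun _ : ℕ => True)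
      (fun n => entourage (U n) n (1 / (n + 1) : ℝ)) := by
    refine (hasBasis_uniformity E).to_hasBasis ?_ fun n _ =>
      ⟨(U n, n, 1 / (n + 1)), ⟨hU.mem n, Nat.one_div_pos_of_nat⟩, Subset.rfl⟩
    rintro ⟨W, T, ε⟩ ⟨hW, hε⟩
    obtain ⟨n, hn⟩ := hU.mem_iff.1 hW
    obtain ⟨m, hm⟩ := exists_nat_ge T
    obtain ⟨k, hk⟩ := exists_nat_one_div_lt hε
    have hkmax : k ≤ max n (max m k) := (le_max_right _ _).trans (le_max_right _ _)
    refine ⟨max n (max m k), trivial, entourage_mono ?_ ?_ ?_⟩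
    · exact (hU.antitone (le_max_left _ _)).trans hn
    · exact hm.trans (by exact_mod_cast (le_max_left m k).trans (le_max_right _ _))
    · exact (by gcongr : (1 / ((max n (max m k) : ℕ) + 1) : ℝ) ≤ 1 / (k + 1)).trans hk.le
  exact HasCountableBasis.isCountablyGenerated ⟨hbasis, to_countable _⟩

theorem tendsto_of_timeChange {ι : Type*} {l : Filter ι} {X : ι → SkorokhodSpace E}
    {x : SkorokhodSpace E} {φ : ι → ℝ≥0 ≃o ℝ≥0} {δ : ι → ℝ}
    (hφ : ∀ i, TimeChangeLE (φ i) (δ i)) (hδ : Tendsto δ l (𝓝 0))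
    (hX : ∀ T, TendstoUniformlyOn (fun i t => X i (φ i t)) x l (Iic T)) : Tendsto X l (𝓝 x) := by
  refine Uniform.tendsto_nhds_right.2 ((hasBasis_uniformity E).tendsto_right_iff.2 ?_)
  rintro ⟨U, T, ε⟩ ⟨hU, hε⟩
  filter_upwards [hδ.eventually_le_const hε, hX T U hU] with i hi hXi
  exact ⟨φ i, (hφ i).mono hi, hXi⟩

theorem tendsto_of_tendstoUniformlyOn {ι : Type*} {l : Filter ι} {X : ι → SkorokhodSpace E}
    {x : SkorokhodSpace E} (hX : ∀ T, TendstoUniformlyOn (fun i t => X i t) x l (Iic T)) :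
    Tendsto X l (𝓝 x) :=
  tendsto_of_timeChange (fun _ => TimeChangeLE.refl le_rfl) tendsto_const_nhds hX

end Uniformity

/-! ### Completeness -/

section Completeness

theorem tendsto_orderIso_nhdsLT (φ : ℝ≥0 ≃o ℝ≥0) (t : ℝ≥0) :
    Tendsto φ (𝓝[<] t) (𝓝[<] (φ t)) :=
  φ.continuous.continuousWithinAt.tendsto_nhdsWithin fun _ hr => φ.strictMono hr

theorem _root_.IsRCLL.comp_orderIso {E : Type*} [TopologicalSpace E] {x : ℝ≥0 → E} (hx : IsRCLL x)
    (φ : ℝ≥0 ≃o ℝ≥0) : IsRCLL fun t => x (φ t) := by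
  refine ⟨fun t => (hx.1 (φ t)).comp φ.continuous.continuousWithinAt fun r hr => φ.monotone hr,
    fun t ht => ?_⟩
  have hφ0 : φ 0 = 0 := φ.map_bot
  obtain ⟨l, hl⟩ := hx.2 (φ t) (hφ0 ▸ φ.strictMono ht)
  exact ⟨l, hl.comp (tendsto_orderIso_nhdsLT φ t)⟩

theorem _root_.IsRCLL.of_tendstoUniformlyOn {E ι : Type*} [UniformSpace E] [CompleteSpace E]
    {l : Filter ι} [l.NeBot] {F : ι → ℝ≥0 → E} {z : ℝ≥0 → E} (hF : ∀ i, IsRCLL (F i))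
    (hlim : ∀ T, TendstoUniformlyOn F z l (Iic T)) : IsRCLL z := by
  refine ⟨fun t => ?_, fun t ht => ?_⟩
  · refine continuousWithinAt_of_locally_uniform_approx_of_continuousWithinAt self_mem_Ici
      fun U hU => ?_
    obtain ⟨i, hi⟩ := (hlim (t + 1) U hU).exists
    exact ⟨Iic (t + 1), mem_nhdsWithin_of_mem_nhds (Iic_mem_nhds (by simp)), F i, (hF i).1 t, hi⟩
  · have : (𝓝[<] t).NeBot := nhdsLT_neBot_of_exists_lt ⟨0, ht⟩
    refine cauchy_map_iff_exists_tendsto.1 (cauchy_map_iff'.2 fun U hU => ?_)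
    obtain ⟨W, hW, hWsymm, hWU⟩ := comp_comp_symm_mem_uniformity_sets hU
    obtain ⟨i, hi⟩ := (hlim t W hW).exists
    obtain ⟨m, hm⟩ := (hF i).2 t ht
    have hcauchy : ∀ᶠ p in 𝓝[<] t ×ˢ 𝓝[<] t, (F i p.1, F i p.2) ∈ W :=
      (cauchy_map_iff.1 hm.cauchy_map).2 hW
    have hlt : ∀ᶠ p in 𝓝[<] t ×ˢ 𝓝[<] t, p.1 < t ∧ p.2 < t :=
      eventually_mem_nhdsWithin.prod_mk eventually_mem_nhdsWithin
    change ∀ᶠ p in 𝓝[<] t ×ˢ 𝓝[<] t, (z p.1, z p.2) ∈ U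
    filter_upwards [hcauchy, hlt] with p hp hpt
    exact hWU ⟨F i p.2, ⟨F i p.1, hi p.1 hpt.1.le, hp⟩, hWsymm.symm _ _ (hi p.2 hpt.2.le)⟩

theorem uniformCauchySeqOn_of_summable {α E : Type*} [PseudoMetricSpace E] {w : ℕ → α → E}
    {s : Set α} {d : ℕ → ℝ} (hd : Summable d)
    (hw : ∀ᶠ n in atTop, ∀ t ∈ s, dist (w n t) (w (n + 1) t) ≤ d n) :
    UniformCauchySeqOn w atTop s := by
  rw [Metric.uniformCauchySeqOn_iff]
  intro ε hε
  obtain ⟨N, hN⟩ := eventually_atTop.1 hw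
  obtain ⟨M, hM⟩ := Metric.cauchySeq_iff.1 hd.hasSum.tendsto_sum_nat.cauchySeq ε hε
  refine ⟨max N M, fun m hm n hn t ht => ?_⟩
  wlog hmn : m ≤ n generalizing m n
  · rw [dist_comm]
    exact this n hn m hm (le_of_not_ge hmn)
  calc dist (w m t) (w n t)
      ≤ ∑ i ∈ Finset.Ico m n, d i := dist_le_Ico_sum_of_dist_le hmn fun {k} hmk _ =>
        hN k ((le_max_left N M).trans (hm.trans hmk)) t ht
    _ = ∑ i ∈ Finset.range n, d i - ∑ i ∈ Finset.range m, d i :=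
        Finset.sum_Ico_eq_sub _ hmn
    _ ≤ dist (∑ i ∈ Finset.range n, d i) (∑ i ∈ Finset.range m, d i) := le_abs_self _
    _ < ε := hM n ((le_max_right N M).trans hn) m ((le_max_right N M).trans hm)

theorem exists_tendstoUniformlyOn_of_uniformCauchySeqOn {α ι κ E : Type*} [UniformSpace E]
    [CompleteSpace E] {l : Filter ι} [l.NeBot] {w : ι → α → E} {s : κ → Set α}
    (hs : ∀ a, ∃ k, a ∈ s k) (hw : ∀ k, UniformCauchySeqOn w l (s k)) :
    ∃ z : α → E, ∀ k, TendstoUniformlyOn w z l (s k) := by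
  choose k hk using hs
  choose z hz using fun a => cauchy_map_iff_exists_tendsto.1 ((hw (k a)).cauchy_map (hk a))
  exact ⟨z, fun k => (hw k).tendstoUniformlyOn_of_tendsto fun a _ => hz a⟩

theorem exists_tendsto_of_dist_le {E : Type*} [PseudoMetricSpace E] [CompleteSpace E]
    {x : ℕ → SkorokhodSpace E} {φ : ℕ → ℝ≥0 ≃o ℝ≥0} {ε : ℕ → ℝ}
    (hφ : ∀ n, TimeChangeLE (φ n) (ε n)) (hε : Summable ε)
    (hx : ∀ n : ℕ, ∀ t ≤ (n : ℝ≥0), dist (x n t) (x (n + 1) (φ n t)) ≤ ε n) :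
    ∃ y, Tendsto x atTop (𝓝 y) := by
  let C : ℝ≥0 := (Real.exp (∑' i, ε i)).toNNReal
  let w : ℕ → ℝ≥0 → E := fun n t => x n (iterTimeChange φ n t)
  have hw (T : ℝ≥0) : UniformCauchySeqOn w atTop (Iic T) := by
    refine uniformCauchySeqOn_of_summable hε ?_
    filter_upwards [tendsto_natCast_atTop_atTop.eventually_ge_atTop (C * T)] with n hn t ht
    exact hx n _ ((iterTimeChange_apply_le hφ hε n t).trans ((mul_le_mul_right ht C).trans hn))
  obtain ⟨z, hz⟩ := exists_tendstoUniformlyOn_of_uniformCauchySeqOn (fun t => ⟨t, self_mem_Iic⟩) hw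
  have hzRCLL : IsRCLL z := .of_tendstoUniformlyOn (fun n => (x n).isRCLL.comp_orderIso _) hz
  obtain ⟨Λ, hΛ⟩ := exists_timeChangeLE_symm_iterTimeChange_trans hφ hε
  refine ⟨⟨fun t => z (Λ.symm t), hzRCLL.comp_orderIso _⟩,
    tendsto_of_timeChange (fun n => (hΛ n).symm) (tendsto_sum_nat_add ε) fun T => ?_⟩
  exact ((hz (Λ.symm T)).comp Λ.symm).mono fun t ht => Λ.symm.monotone ht

theorem completeSpace_of_pseudoMetricSpace (E : Type*) [PseudoMetricSpace E] [CompleteSpace E] :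
    CompleteSpace (SkorokhodSpace E) := by
  refine UniformSpace.complete_of_convergent_controlled_sequences
    (fun n => entourage {p : E × E | dist p.1 p.2 < (1 / 2) ^ n} n ((1 / 2) ^ n))
    (fun n => entourage_mem_uniformity (Metric.dist_mem_uniformity (by positivity)) _
      (by positivity)) fun x hx => ?_
  choose φ hφ hxφ using fun n : ℕ => hx n n (n + 1) le_rfl n.le_succ
  exact exists_tendsto_of_dist_le hφ summable_geometric_two fun n t ht => (hxφ n t ht).le

instance completeSpace {E : Type*} [UniformSpace E] [(𝓤 E).IsCountablyGenerated]
    [CompleteSpace E] : CompleteSpace (SkorokhodSpace E) := by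
  let := UniformSpace.pseudoMetricSpace E
  exact completeSpace_of_pseudoMetricSpace E

end Completeness

/-! ### Separability -/

section Concatenation

variable {E : Type*} [TopologicalSpace E]

/-- The constant path at `v`. -/
def const (v : E) : SkorokhodSpace E where
  toFun _ := v
  isRCLL := ⟨fun _ => continuousWithinAt_const, fun _ _ => ⟨v, tendsto_const_nhds⟩⟩

theorem tendsto_tsub_nhdsLT {d t : ℝ≥0} (hdt : d < t) :
    Tendsto (fun r => r - d) (𝓝[<] t) (𝓝[<] (t - d)) := by
  have hcont : Continuous fun r : ℝ≥0 => r - d := by fun_prop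
  refine tendsto_nhdsWithin_of_tendsto_nhds_of_eventually_within _
    (hcont.continuousWithinAt (s := Iio t)) ?_
  filter_upwards [Ioo_mem_nhdsLT hdt] with r hr using tsub_lt_tsub_right_of_le hr.1.le hr.2

/-- The path that follows `x` during `[0,d)` and then runs through `y` from its beginning. Step
paths and paths stopped just before time `d` are built from it. -/
noncomputable def concat (x : SkorokhodSpace E) (d : ℝ≥0) (y : SkorokhodSpace E) :
    SkorokhodSpace E where
  toFun t := if t < d then x t else y (t - d)
  isRCLL := by
    refine ⟨fun t => ?_, fun t ht => ?_⟩
    · rcases lt_or_ge t d with htd | hdt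
      · refine (x.isRCLL.1 t).congr_of_eventuallyEq ?_ (if_pos htd)
        filter_upwards [mem_nhdsWithin_of_mem_nhds (Iio_mem_nhds htd)] with r hr using if_pos hr
      · have hshift : ContinuousWithinAt (fun r => y (r - d)) (Ici t) t :=
          (y.isRCLL.1 (t - d)).comp (f := fun r => r - d) (by fun_prop)
            fun r hr => tsub_le_tsub_right hr d
        exact hshift.congr (fun r hr => if_neg (hdt.trans hr).not_gt) (if_neg hdt.not_gt)
    · rcases le_or_gt t d with htd | hdt
      · obtain ⟨l, hl⟩ := x.isRCLL.2 t ht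
        refine ⟨l, hl.congr' ?_⟩
        filter_upwards [self_mem_nhdsWithin] with r hr using (if_pos (hr.trans_le htd)).symm
      · obtain ⟨l, hl⟩ := y.isRCLL.2 (t - d) (tsub_pos_of_lt hdt)
        refine ⟨l, (hl.comp (tendsto_tsub_nhdsLT hdt)).congr' ?_⟩
        filter_upwards [Ioo_mem_nhdsLT hdt] with r hr using (if_neg hr.1.not_gt).symm

theorem concat_apply_of_lt (x y : SkorokhodSpace E) {d t : ℝ≥0} (htd : t < d) :
    concat x d y t = x t :=
  if_pos htd

theorem concat_apply_of_le (x y : SkorokhodSpace E) {d t : ℝ≥0} (hdt : d ≤ t) :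
    concat x d y t = y (t - d) :=
  if_neg hdt.not_gt

theorem concat_apply_add (x y : SkorokhodSpace E) (d t : ℝ≥0) : concat x d y (d + t) = y t := by
  rw [concat_apply_of_le x y le_self_add, add_tsub_cancel_left]

theorem concat_mem_entourage {U : Set (E × E)} {T : ℝ≥0} {ε : ℝ} {x x' y y' : SkorokhodSpace E}
    {φ : ℝ≥0 ≃o ℝ≥0} {d : ℝ≥0} (hφ : TimeChangeLE φ ε) (hx : ∀ t < d, (x t, x' (φ t)) ∈ U)
    (hy : (y, y') ∈ entourage U T ε) :
    (concat x d y, concat x' (φ d) y') ∈ entourage U T ε := by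
  obtain ⟨ψ, hψ, hyψ⟩ := hy
  obtain ⟨χ, hχ, hχ_le, hχ_add⟩ := hφ.exists_concat hψ d
  refine ⟨χ, hχ, fun t ht => ?_⟩
  dsimp only
  rcases lt_or_ge t d with htd | hdt
  · rw [concat_apply_of_lt _ _ htd, hχ_le t htd.le, concat_apply_of_lt _ _ (φ.strictMono htd)]
    exact hx t htd
  · obtain ⟨r, rfl⟩ := exists_add_of_le hdt
    rw [hχ_add, concat_apply_add, concat_apply_add]
    exact hyψ r (le_add_self.trans ht)

/-- The step path with the given list of holding times and values, resting at `v` afterwards. -/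
noncomputable def step : List (ℝ≥0 × E) → E → SkorokhodSpace E
  | [], v => const v
  | p :: l, v => concat (const p.2) p.1 (step l v)

/-- The step paths with rational holding times and values in `s`. -/
def rationalSteps (s : Set E) : Set (SkorokhodSpace E) :=
  range fun p : List (ℚ≥0 × s) × s => step (p.1.map fun q => ((q.1 : ℝ≥0), (q.2 : E))) p.2

variable {s : Set E} {v : E}

theorem countable_rationalSteps (hs : s.Countable) : (rationalSteps s).Countable := by
  have := hs.to_subtype
  exact countable_range _

theorem const_mem_rationalSteps (hv : v ∈ s) : const v ∈ rationalSteps s :=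
  ⟨([], ⟨v, hv⟩), rfl⟩

theorem concat_const_mem_rationalSteps (hv : v ∈ s) (q : ℚ≥0) {y : SkorokhodSpace E}
    (hy : y ∈ rationalSteps s) : concat (const v) q y ∈ rationalSteps s := by
  obtain ⟨⟨l, w⟩, rfl⟩ := hy
  exact ⟨((q, ⟨v, hv⟩) :: l, w), rfl⟩

end Concatenation

section NearConst

variable {E : Type*} {U : Set (E × E)} {x : ℝ≥0 → E}

/-- The path `x` is `U`-close to some constant on the nonempty interval `[a,b)`. A chain of such
intervals is a partition on which `x` oscillates little. -/
def NearConst (U : Set (E × E)) (x : ℝ≥0 → E) (a b : ℝ≥0) : Prop :=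
  a < b ∧ ∃ v, ∀ t ∈ Ico a b, (x t, v) ∈ U

theorem reflTransGen_nearConst_of_le {S T : ℝ≥0} (hT : Relation.ReflTransGen (NearConst U x) 0 T)
    (hST : S ≤ T) : Relation.ReflTransGen (NearConst U x) 0 S := by
  induction hT with
  | refl => rw [nonpos_iff_eq_zero.1 hST]
  | @tail b c hb hbc ih =>
    rcases le_or_gt S b with hSb | hbS
    · exact ih hSb
    · obtain ⟨-, v, hv⟩ := hbc
      exact hb.tail ⟨hbS, v, fun t ht => hv t (Ico_subset_Ico_right hST ht)⟩

variable [UniformSpace E]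

theorem _root_.IsRCLL.eventually_nearConst_nhdsLT (hx : IsRCLL x) (hU : U ∈ 𝓤 E) {c : ℝ≥0}
    (hc : 0 < c) : ∀ᶠ a in 𝓝[<] c, NearConst U x a c := by
  obtain ⟨l, hl⟩ := hx.2 c hc
  obtain ⟨δ, hδ, hδU⟩ :=
    (mem_nhdsLT_iff_exists_Ioo_subset' hc).1 (Uniform.tendsto_nhds_left.1 hl hU)
  filter_upwards [Ioo_mem_nhdsLT hδ] with a ha
  exact ⟨ha.2, l, fun t ht => hδU ⟨ha.1.trans_le ht.1, ht.2⟩⟩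

theorem _root_.IsRCLL.eventually_nearConst_nhdsGT (hx : IsRCLL x) (hU : U ∈ 𝓤 E) (c : ℝ≥0) :
    ∀ᶠ b in 𝓝[>] c, NearConst U x c b := by
  obtain ⟨u, hu, hcu⟩ :=
    mem_nhdsGE_iff_exists_Ico_subset.1 (Uniform.tendsto_nhds_left.1 (hx.1 c) hU)
  filter_upwards [Ioo_mem_nhdsGT hu] with b hb
  exact ⟨hb.1, x c, fun t ht => hcu ⟨ht.1, ht.2.trans hb.2⟩⟩

theorem _root_.IsRCLL.reflTransGen_nearConst (hx : IsRCLL x) (hU : U ∈ 𝓤 E) (T : ℝ≥0) :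
    Relation.ReflTransGen (NearConst U x) 0 T := by
  set R : Set ℝ≥0 := {c | Relation.ReflTransGen (NearConst U x) 0 c}
  have hopen : IsOpen R := isOpen_iff_mem_nhds.2 fun c hc => by
    obtain ⟨b, hcb⟩ := (hx.eventually_nearConst_nhdsGT hU c).exists
    exact mem_of_superset (Iio_mem_nhds hcb.1) fun a ha =>
      reflTransGen_nearConst_of_le (hc.tail hcb) (le_of_lt ha)
  have hclosed : IsClosed R := isClosed_iff_frequently.2 fun c hc => by
    rcases eq_zero_or_pos c with rfl | hc0
    · exact .refl
    obtain ⟨δ, hδ, hδc⟩ :=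
      (mem_nhdsLT_iff_exists_Ioo_subset' hc0).1 (hx.eventually_nearConst_nhdsLT hU hc0)
    obtain ⟨a, ha, hδa⟩ := (hc.and_eventually (Ioi_mem_nhds hδ)).exists
    rcases lt_or_ge a c with hac | hca
    · exact Relation.ReflTransGen.tail ha (hδc ⟨hδa, hac⟩)
    · exact reflTransGen_nearConst_of_le ha hca
  have hR : R = univ := IsClopen.eq_univ ⟨hclosed, hopen⟩ ⟨0, .refl⟩
  exact hR.ge (mem_univ T)

end NearConst

section Separability

variable {E : Type*} [UniformSpace E] {s : Set E}

protected theorem continuous_const : Continuous (const : E → SkorokhodSpace E) :=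
  continuous_iff_continuousAt.2 fun v => tendsto_of_tendstoUniformlyOn fun _ _ hU =>
    mem_of_superset (mem_nhds_left v hU) fun _ hw _ _ => hw

theorem const_mem_closure_rationalSteps (hs : Dense s) (v : E) :
    const v ∈ closure (rationalSteps s) :=
  map_mem_closure SkorokhodSpace.continuous_const (hs v) fun _ => const_mem_rationalSteps

theorem exists_nnrat_timeChangeLE_apply_eq {d : ℝ≥0} (hd : 0 < d) {ε : ℝ} (hε : 0 < ε) :
    ∃ (q : ℚ≥0) (φ : ℝ≥0 ≃o ℝ≥0), TimeChangeLE φ ε ∧ φ d = q := by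
  have hd' : (0 : ℝ) < d := hd
  obtain ⟨q, hdq, hqd⟩ :=
    exists_rat_btwn (lt_mul_of_one_lt_left hd' (Real.one_lt_exp_iff.2 hε))
  lift q to ℚ≥0 using Rat.cast_nonneg.1 (hd'.trans hdq).le
  have hcast : (((q : ℚ≥0) : ℚ) : ℝ) = ((q : ℝ≥0) : ℝ) := by norm_cast
  rw [hcast] at hdq hqd
  refine ⟨q, OrderIso.mulRight₀ (q / d) (div_pos (hd.trans hdq) hd),
    TimeChangeLE.mulRight₀ _ ?_ ?_, mul_div_cancel₀ _ hd.ne'⟩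
  · rw [NNReal.coe_div, le_div_iff₀ hd']
    exact (mul_le_of_le_one_left hd'.le (Real.exp_le_one_iff.2 (by linarith))).trans hdq.le
  · rw [NNReal.coe_div, div_le_iff₀ hd']
    exact hqd.le

theorem concat_const_mem_closure_rationalSteps (hs : Dense s) (v : E) {d : ℝ≥0} (hd : 0 < d)
    {y : SkorokhodSpace E} (hy : y ∈ closure (rationalSteps s)) :
    concat (const v) d y ∈ closure (rationalSteps s) := by
  refine UniformSpace.mem_closure_iff_ball.2 fun {V} hV => ?_
  obtain ⟨⟨U, T, ε⟩, ⟨hU, hε⟩, hUV⟩ := (hasBasis_uniformity E).mem_iff.1 hV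
  obtain ⟨v', hv's, hvv'⟩ := hs.inter_nhds_nonempty (UniformSpace.ball_mem_nhds v hU)
  obtain ⟨y', hyy', hy's⟩ :=
    UniformSpace.mem_closure_iff_ball.1 hy (entourage_mem_uniformity hU T hε)
  obtain ⟨q, φ, hφ, hφd⟩ := exists_nnrat_timeChangeLE_apply_eq hd hε
  refine ⟨concat (const v') q y', hUV ?_, concat_const_mem_rationalSteps hv's q hy's⟩
  rw [← hφd]
  exact concat_mem_entourage hφ (fun _ _ => hvv') hyy'

theorem exists_mem_closure_rationalSteps (hs : Dense s) (x : SkorokhodSpace E)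
    {U : Set (E × E)} (hU : U ∈ 𝓤 E) {a T : ℝ≥0}
    (haT : Relation.ReflTransGen (NearConst U x) a T) :
    ∃ y ∈ closure (rationalSteps s), ∀ t, a + t ≤ T → (x (a + t), y t) ∈ U := by
  induction haT using Relation.ReflTransGen.head_induction_on with
  | refl =>
    refine ⟨const (x T), const_mem_closure_rationalSteps hs _, fun t ht => ?_⟩
    obtain rfl : t = 0 := by simpa using ht
    rw [add_zero]
    exact refl_mem_uniformity hU
  | @head a b hab _ ih =>
    obtain ⟨hlt, v, hv⟩ := hab
    obtain ⟨y, hy, hxy⟩ := ih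
    refine ⟨concat (const v) (b - a) y,
      concat_const_mem_closure_rationalSteps hs v (tsub_pos_of_lt hlt) hy, fun t ht => ?_⟩
    rcases lt_or_ge t (b - a) with htba | htba
    · rw [concat_apply_of_lt _ _ htba]
      exact hv _ ⟨le_self_add, lt_tsub_iff_left.1 htba⟩
    · obtain ⟨r, rfl⟩ := exists_add_of_le htba
      rw [← add_assoc, add_tsub_cancel_of_le hlt.le] at ht ⊢
      rw [concat_apply_add]
      exact hxy r ht

theorem dense_rationalSteps (hs : Dense s) : Dense (rationalSteps s) := by
  refine dense_closure.1 fun x => UniformSpace.mem_closure_iff_ball.2 fun {V} hV => ?_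
  obtain ⟨⟨U, T, ε⟩, ⟨hU, hε⟩, hUV⟩ := (hasBasis_uniformity E).mem_iff.1 hV
  obtain ⟨y, hy, hxy⟩ :=
    exists_mem_closure_rationalSteps hs x hU (x.isRCLL.reflTransGen_nearConst hU T)
  simp only [zero_add] at hxy
  exact ⟨y, hUV ⟨OrderIso.refl _, TimeChangeLE.refl hε.le, hxy⟩, hy⟩

instance separableSpace [TopologicalSpace.SeparableSpace E] :
    TopologicalSpace.SeparableSpace (SkorokhodSpace E) := by
  obtain ⟨s, hs, hd⟩ := TopologicalSpace.exists_countable_dense E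
  exact ⟨rationalSteps s, countable_rationalSteps hs, dense_rationalSteps hd⟩

end Separability

/-! ### Borel sets and evaluations -/

section Evaluation

theorem _root_.IsRCLL.mem_of_forall_mem_Ioo {E : Type*} [TopologicalSpace E] {x : ℝ≥0 → E}
    (hx : IsRCLL x) {F : Set E} (hF : IsClosed F) {s t : ℝ≥0} (hst : s < t)
    (h : ∀ r ∈ Ioo s t, x r ∈ F) : x s ∈ F := by
  have hlim : Tendsto x (𝓝[>] s) (𝓝 (x s)) := (hx.1 s).mono Ioi_subset_Ici_self
  exact hF.mem_of_tendsto hlim (mem_of_superset (Ioo_mem_nhdsGT hst) h)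

theorem _root_.IsRCLL.exists_nat_forall_mem_Ioo {E : Type*} [TopologicalSpace E] {x : ℝ≥0 → E}
    (hx : IsRCLL x) {s : ℝ≥0} {V : Set E} (hV : V ∈ 𝓝 (x s)) :
    ∃ n : ℕ, ∀ r ∈ Ioo s (s + 1 / (n + 1)), x r ∈ V := by
  obtain ⟨u, hsu, huV⟩ := mem_nhdsGE_iff_exists_Ico_subset.1 (hx.1 s hV)
  obtain ⟨n, hn⟩ := exists_nat_one_div_lt (tsub_pos_of_lt (mem_Ioi.1 hsu))
  exact ⟨n, fun r hr => huV ⟨hr.1.le, hr.2.trans (lt_tsub_iff_left.1 hn)⟩⟩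

theorem ext_of_dense {E : Type*} [TopologicalSpace E] [T2Space E] {D : Set ℝ≥0} (hD : Dense D)
    {x y : SkorokhodSpace E} (h : ∀ s ∈ D, x s = y s) : x = y := by
  ext s
  have hne : (𝓝[Ioi s ∩ D] s).NeBot := by
    rw [← mem_closure_iff_nhdsWithin_neBot]
    refine closure_minimal (hD.open_subset_closure_inter isOpen_Ioi) isClosed_closure ?_
    rw [closure_Ioi]
    exact self_mem_Ici
  have hle : 𝓝[Ioi s ∩ D] s ≤ 𝓝[≥] s :=
    nhdsWithin_mono s (inter_subset_left.trans Ioi_subset_Ici_self)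
  refine tendsto_nhds_unique ((x.isRCLL.1 s).mono_left hle)
    (((y.isRCLL.1 s).mono_left hle).congr' ?_)
  filter_upwards [self_mem_nhdsWithin] with r hr using (h r hr.2).symm

variable {E : Type*} [UniformSpace E]

theorem isOpen_setOf_exists_mem {I : Set ℝ≥0} (hI : IsOpen I) {U : Set E} (hU : IsOpen U) :
    IsOpen {x : SkorokhodSpace E | ∃ r ∈ I, x r ∈ U} := by
  refine isOpen_iff_mem_nhds.2 ?_
  rintro x ⟨r, hrI, hrU⟩
  obtain ⟨ε, hε, hφI⟩ := TimeChangeLE.exists_pos_forall_apply_mem (hI.mem_nhds hrI)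
  obtain ⟨W, hW, hWU⟩ := UniformSpace.mem_nhds_iff.1 (hU.mem_nhds hrU)
  refine mem_of_superset (UniformSpace.ball_mem_nhds x (entourage_mem_uniformity hW r hε)) ?_
  rintro y ⟨φ, hφ, hxy⟩
  exact ⟨φ r, hφI φ hφ, hWU (hxy r le_rfl)⟩

theorem isClosed_setOf_forall_mem {I : Set ℝ≥0} (hI : IsOpen I) {F : Set E} (hF : IsClosed F) :
    IsClosed {x : SkorokhodSpace E | ∀ r ∈ I, x r ∈ F} := by
  have hopen := isOpen_setOf_exists_mem hI hF.isOpen_compl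
  simpa [← isOpen_compl_iff, compl_ofPred] using hopen

instance t0Space [T0Space E] : T0Space (SkorokhodSpace E) := by
  refine ⟨fun x y hxy => SkorokhodSpace.ext (funext fun s => ?_)⟩
  have hspec : y s ⤳ x s := specializes_iff_forall_open.2 fun U hU hxU => by
    obtain ⟨F, ⟨hFx, hF⟩, hFU⟩ := (closed_nhds_basis (x s)).mem_iff.1 (hU.mem_nhds hxU)
    obtain ⟨n, hn⟩ := x.isRCLL.exists_nat_forall_mem_Ioo hFx
    have hy := (hxy.mem_closed_iff (isClosed_setOf_forall_mem isOpen_Ioo hF)).1 hn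
    exact hFU (y.isRCLL.mem_of_forall_mem_Ioo hF (lt_add_of_pos_right s (by positivity)) hy)
  exact hspec.eq.symm

theorem setOf_eval_mem_eq_iUnion {B : Set (Set E)} (hB : TopologicalSpace.IsTopologicalBasis B)
    (s : ℝ≥0) {U : Set E} (hU : IsOpen U) :
    {x : SkorokhodSpace E | x s ∈ U} = ⋃ C ∈ {C ∈ B | closure C ⊆ U}, ⋃ n : ℕ,
      {x : SkorokhodSpace E | ∀ r ∈ Ioo s (s + 1 / (n + 1)), x r ∈ closure C} := by
  ext x
  simp only [mem_iUnion, mem_ofPred_eq, exists_prop]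
  constructor
  · intro hx
    obtain ⟨C, hCB, hxC, hCU⟩ := hB.exists_closure_subset (hU.mem_nhds hx)
    obtain ⟨n, hn⟩ := x.isRCLL.exists_nat_forall_mem_Ioo ((hB.isOpen hCB).mem_nhds hxC)
    exact ⟨C, ⟨hCB, hCU⟩, n, fun r hr => subset_closure (hn r hr)⟩
  · rintro ⟨C, ⟨-, hCU⟩, n, hn⟩
    exact hCU (x.isRCLL.mem_of_forall_mem_Ioo isClosed_closure
      (lt_add_of_pos_right s (by positivity)) hn)

theorem measurable_eval [SecondCountableTopology E] (s : ℝ≥0) :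
    Measurable[borel (SkorokhodSpace E), borel E] fun x : SkorokhodSpace E => x s := by
  borelize E (SkorokhodSpace E)
  refine measurable_of_isOpen fun U hU => ?_
  have hcountable := TopologicalSpace.countable_countableBasis E
  change MeasurableSet {x : SkorokhodSpace E | x s ∈ U}
  rw [setOf_eval_mem_eq_iUnion (TopologicalSpace.isBasis_countableBasis E) s hU]
  exact .biUnion (hcountable.mono (sep_subset _ _)) fun C _ => .iUnion fun n =>
    (isClosed_setOf_forall_mem isOpen_Ioo isClosed_closure).measurableSet

theorem evalSigma_le_borel [SecondCountableTopology E] (t : ℝ≥0) :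
    evalSigma E t ≤ borel (SkorokhodSpace E) :=
  iSup_le fun s => (measurable_eval (s : ℝ≥0)).comap_le

end Evaluation

section EvalSigma

variable {E : Type*} [TopologicalSpace E]

theorem comap_eval_le_evalSigma {s t : ℝ≥0} (hst : s ≤ t) :
    (borel E).comap (fun x : SkorokhodSpace E => x s) ≤ evalSigma E t :=
  le_iSup (fun r : Iic t => (borel E).comap fun x : SkorokhodSpace E => x r) ⟨s, hst⟩

theorem evalSigma_mono : Monotone (evalSigma E) :=
  fun _ _ hst => iSup_le fun r => comap_eval_le_evalSigma (r.2.trans hst)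

end EvalSigma

section Polish

variable (E : Type*) [UniformSpace E] [CompleteSpace E] [(𝓤 E).IsCountablyGenerated] [T0Space E]
  [TopologicalSpace.SeparableSpace E]

instance polishSpace : PolishSpace (SkorokhodSpace E) := by
  have := UniformSpace.secondCountable_of_separable (SkorokhodSpace E)
  infer_instance

theorem borel_eq_iSup_eval :
    borel (SkorokhodSpace E) =
      ⨆ s : ℝ≥0, (borel E).comap (fun x : SkorokhodSpace E => x s) := by
  have := UniformSpace.secondCountable_of_separable E
  refine le_antisymm ?_ (iSup_le fun s => (measurable_eval s).comap_le)
  borelize E (SkorokhodSpace E)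
  obtain ⟨D, hDcountable, hD⟩ := TopologicalSpace.exists_countable_dense ℝ≥0
  have := hDcountable.to_subtype
  let evalOn : SkorokhodSpace E → (D → E) := fun x s => x s
  have hmeas : Measurable evalOn := measurable_pi_lambda _ fun s => measurable_eval (s : ℝ≥0)
  have hinj : Function.Injective evalOn := fun x y h =>
    ext_of_dense hD fun s hs => congrFun h ⟨s, hs⟩
  refine (hmeas.measurableEmbedding hinj).comap_eq.ge.trans ?_
  rw [MeasurableSpace.pi, MeasurableSpace.comap_iSup]
  refine iSup_le fun s => ?_
  rw [MeasurableSpace.comap_comp]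
  exact le_iSup (fun s : ℝ≥0 => (borel E).comap fun x : SkorokhodSpace E => x s) s

theorem comap_theta_borel (t : ℝ≥0) :
    (borel (SkorokhodSpace E)).comap (theta t) = evalSigma E t := by
  rw [borel_eq_iSup_eval, MeasurableSpace.comap_iSup]
  simp_rw [MeasurableSpace.comap_comp]
  refine le_antisymm (iSup_le fun s => comap_eval_le_evalSigma (min_le_right s t))
    (iSup_le fun s => le_iSup_of_le (s : ℝ≥0) ?_)
  have heval : (fun x : SkorokhodSpace E => x s) ∘ theta t = fun x => x s := by
    ext x
    simp [theta, min_eq_left (mem_Iic.1 s.2)]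
  rw [heval]

theorem filtration_eq_evalSigma (t : ℝ≥0) : filtration E t = evalSigma E t := by
  rw [← comap_theta_borel, filtration, instTopologicalSpaceSubtype, borel_comap,
    MeasurableSpace.comap_comp]
  rfl

end Polish

/-! ### The process of stopped paths -/

section StoppedPaths

variable {E : Type*} [UniformSpace E]

theorem continuousWithinAt_theta (x : SkorokhodSpace E) (t : ℝ≥0) :
    ContinuousWithinAt (fun s => theta s x) (Ici t) t := by
  refine tendsto_of_tendstoUniformlyOn fun T U hU => ?_
  obtain ⟨u, hu, huU⟩ :=
    mem_nhdsGE_iff_exists_Ico_subset.1 (Uniform.tendsto_nhds_right.1 (x.isRCLL.1 t) hU)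
  filter_upwards [Ico_mem_nhdsGE hu] with s hs r _
  change (x (min r t), x (min r s)) ∈ U
  rcases le_total r t with hrt | htr
  · rw [min_eq_left hrt, min_eq_left (hrt.trans hs.1)]
    exact refl_mem_uniformity hU
  · rw [min_eq_right htr]
    exact huU ⟨le_min htr hs.1, (min_le_right _ _).trans_lt hs.2⟩

theorem tendsto_theta_nhdsLT (x : SkorokhodSpace E) {t : ℝ≥0} (ht : 0 < t) {l : E}
    (hl : Tendsto x (𝓝[<] t) (𝓝 l)) :
    Tendsto (fun s => theta s x) (𝓝[<] t) (𝓝 (concat x t (const l))) := by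
  refine tendsto_of_tendstoUniformlyOn fun T U hU => ?_
  obtain ⟨W, hW, hWsymm, hWU⟩ := comp_symm_mem_uniformity_sets hU
  obtain ⟨δ, hδ, hδW⟩ :=
    (mem_nhdsLT_iff_exists_Ioo_subset' ht).1 (Uniform.tendsto_nhds_right.1 hl hW)
  filter_upwards [Ioo_mem_nhdsLT hδ] with s hs r _
  change (concat x t (const l) r, x (min r s)) ∈ U
  have hsW : (l, x s) ∈ W := hδW hs
  rcases lt_or_ge r t with hrt | htr
  · rw [concat_apply_of_lt _ _ hrt]
    rcases le_total r s with hrs | hsr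
    · rw [min_eq_left hrs]
      exact refl_mem_uniformity hU
    · rw [min_eq_right hsr]
      exact hWU ⟨l, hWsymm.symm _ _ (hδW ⟨hs.1.trans_le hsr, hrt⟩), hsW⟩
  · rw [concat_apply_of_le _ _ htr, min_eq_right (hs.2.le.trans htr)]
    exact hWU ⟨l, refl_mem_uniformity hW, hsW⟩

theorem isRCLL_xiStar (x : SkorokhodSpace E) : IsRCLL fun t => xiStar t x := by
  refine ⟨fun t => continuousWithinAt_id.prodMk (continuousWithinAt_theta x t), fun t ht => ?_⟩
  obtain ⟨l, hl⟩ := x.isRCLL.2 t ht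
  exact ⟨(t, concat x t (const l)), (tendsto_nhds_of_tendsto_nhdsWithin tendsto_id).prodMk_nhds
    (tendsto_theta_nhdsLT x ht hl)⟩

/-- The path `ξ*(·, x)`; as a map from `D_E[0,∞)` to `D_{E*}[0,∞)` this is the paper's `ξ̃*`. -/
def xiStarPath (x : SkorokhodSpace E) : SkorokhodSpace (EStar E) where
  toFun t := xiStar t x
  isRCLL := isRCLL_xiStar x

variable (E) [CompleteSpace E] [(𝓤 E).IsCountablyGenerated] [T0Space E]
  [TopologicalSpace.SeparableSpace E]

theorem comap_xiStar_borel (t : ℝ≥0) :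
    (borel (EStar E)).comap (xiStar t) = evalSigma E t := by
  borelize (SkorokhodSpace E)
  rw [← BorelSpace.measurable_eq (α := EStar E), Prod.instMeasurableSpace,
    MeasurableSpace.prod, MeasurableSpace.comap_sup, MeasurableSpace.comap_comp,
    MeasurableSpace.comap_comp, ← comap_theta_borel]
  change MeasurableSpace.comap (fun _ => t) _ ⊔ MeasurableSpace.comap (theta t) _ = _
  rw [MeasurableSpace.comap_const, bot_sup_eq]

theorem measurable_xiStar (t : ℝ≥0) :
    Measurable[borel (SkorokhodSpace E), borel (EStar E)]
      fun x : SkorokhodSpace E => xiStar t x := by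
  have := UniformSpace.secondCountable_of_separable E
  exact measurable_iff_comap_le.2 ((comap_xiStar_borel E t).trans_le (evalSigma_le_borel t))

theorem comap_xiStarPath_evalSigma (t : ℝ≥0) :
    (evalSigma (EStar E) t).comap xiStarPath = evalSigma E t := by
  rw [evalSigma, MeasurableSpace.comap_iSup]
  simp_rw [MeasurableSpace.comap_comp]
  change ⨆ s : Iic t, (borel (EStar E)).comap (xiStar (s : ℝ≥0)) = _
  simp_rw [comap_xiStar_borel]
  exact le_antisymm (iSup_le fun s => evalSigma_mono s.2)
    (le_iSup (fun s : Iic t => evalSigma E s) ⟨t, self_mem_Iic⟩)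

theorem comap_xiStarPath_filtration (t : ℝ≥0) :
    (filtration (EStar E) t).comap xiStarPath = filtration E t := by
  rw [filtration_eq_evalSigma, filtration_eq_evalSigma, comap_xiStarPath_evalSigma]

end StoppedPaths

end SkorokhodSpace

theorem mainTheorem3 (E : Type*) [MetricSpace E] [CompleteSpace E]
    [TopologicalSpace.SeparableSpace E] :
    PolishSpace (SkorokhodSpace E) ∧ PolishSpace (SkorokhodSpace.EStar E) ∧
    (∀ t : ℝ≥0, Measurable[borel (SkorokhodSpace E), borel (SkorokhodSpace.EStar E)]
      (fun x : SkorokhodSpace E => SkorokhodSpace.xiStar t x)) ∧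
    ∃ hξ : ∀ x : SkorokhodSpace E, IsRCLL (fun t => SkorokhodSpace.xiStar t x),
      ∀ t : ℝ≥0,
        (SkorokhodSpace.filtration (SkorokhodSpace.EStar E) t).comap
            (fun x => (⟨fun s => SkorokhodSpace.xiStar s x, hξ x⟩ : SkorokhodSpace (SkorokhodSpace.EStar E))) =
          SkorokhodSpace.filtration E t ∧
        SkorokhodSpace.filtration E t = SkorokhodSpace.evalSigma E t ∧
        SkorokhodSpace.filtration (SkorokhodSpace.EStar E) t = SkorokhodSpace.evalSigma (SkorokhodSpace.EStar E) t := by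
  refine ⟨inferInstance, inferInstance, SkorokhodSpace.measurable_xiStar E,
    SkorokhodSpace.isRCLL_xiStar, fun t => ⟨?_, ?_, ?_⟩⟩
  · exact SkorokhodSpace.comap_xiStarPath_filtration E t
  · exact SkorokhodSpace.filtration_eq_evalSigma E t
  · exact SkorokhodSpace.filtration_eq_evalSigma (SkorokhodSpace.EStar E) t
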